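/- **Setting.** Let $G$ be a locally compact second countable Hausdorff group, $H$ a closed subgroup, $\mu_G,\mu_H$ left Haar measures and $\Delta_G,\Delta_H$ the modular functions, normalised by $\mu(Eg)=\Delta(g)\mu(E)$. Hilbert spaces are complex and separable, and a representation is a strongly continuous unitary representation. Fix a continuous function $\theta:G\to[0,\infty)$ such that $\int_H\theta(gh)\,d\mu_H(h)=1$ for all $g\in G$ and $KH\cap\operatorname{supp}\theta$ is compact for every compact $K\subseteq G$. Let $\pi$ be a representation of $G$ on $\mathcal H$ and $\sigma$ a representation of $H$ on $\mathcal K$. The Gårding domain of a representation $\pi$ is $\mathcal G_\pi=\operatorname{span}\{\int_G f(g)\pi(g)u\,d\mu_G(g) : f\in C_c(G),\ u\in\mathcal H\}$. Call a function $F:G\to\mathcal K$ *covariant* if it is $\mu_G$-measurable and for every $h\in H$ one has $$F(gh)=\sqrt{\Delta_H(h)/\Delta_G(h)}\;\sigma(h^{-1})F(g)\quad\text{for }\mu_G\text{-almost all }g .$$ Let $\mathcal F^\sigma\subseteq L^2(G,\theta\mu_G;\mathcal K)$ be the space of classes of covariant functions $F$ with $\int_G\|F(g)\|^2\theta(g)\,d\mu_G(g)<\infty$.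 (Two covariant functions that agree $\theta\mu_G$-a.e. agree $\mu_G$-a.e.) The induced representation $\mathrm{Ind}\,\sigma$ acts on $\mathcal F^\sigma$ by $(\mathrm{Ind}_gF)(g')=F(g^{-1}g')$. A linear map $A:\mathcal G_\pi\to\mathcal K$ is *admissible for $\pi$ modulo $(H,\sigma)$* if $\sigma(h)Av=\sqrt{\Delta_H(h)/\Delta_G(h)}\,A\pi(h)v$ for all $h\in H$, $v\in\mathcal G_\pi$; for every $v\in\mathcal G_\pi$ the function $(W_Av)(g)=A\pi(g^{-1})v$ is $\mu_G$-measurable; and there is $\beta>0$ with $\int_G\|(W_Av)(g)\|^2\theta(g)\,d\mu_G(g)\le\beta\|v\|^2$ for all $v\in\mathcal G_\pi$. **Theorem (Weak Frobenius theorem).** Let $A$ be an admissible map for $\pi$ modulo $(H,\sigma)$. Then: 1. for every $v\in\mathcal G_\pi$ the function $W_Av$ is covariant and its class lies in $\mathcal G_{\mathrm{Ind}\,\sigma}\subseteq\mathcal F^\sigma$; moreover $W_Av$ agrees $\mu_G$-almost everywhere with a continuous function; 2. there is a unique bounded operator $W_A:\mathcal H\to\mathcal F^\sigma$ that sends each $v\in\mathcal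 G_\pi$ to the class of the function $W_Av$, and it intertwines $\pi$ and $\mathrm{Ind}\,\sigma$. Conversely, let $W:\mathcal H\to\mathcal F^\sigma$ be a bounded operator intertwining $\pi$ and $\mathrm{Ind}\,\sigma$. Then for every $v\in\mathcal G_\pi$ the class $Wv$ has a (necessarily unique) continuous covariant representative, again written $Wv$, and there is a unique admissible map $A$ such that, for every $v\in\mathcal G_\pi$, $(Wv)(g)=(W_Av)(g)$ for all $g\in G$; it is given by $Av=(Wv)(e)$. -/

import Mathlib

open MeasureTheory Set
open scoped ENNReal NNReal Pointwise

namespace WeakFrobenius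

/-! ### Haar measures and modular functions -/

section Modular

set_option linter.unusedSectionVars false

variable {G : Type*} [Group G] [TopologicalSpace G] [IsTopologicalGroup G] [LocallyCompactSpace G]

/-- The modular function `Δ` of `G`, normalised by `μ (E g) = Δ g * μ E` for a left Haar measure
`μ`, equivalently `∫ f (x g⁻¹) dμ x = Δ g * ∫ f dμ`.  Mathlib's `modularCharacter` is the scalar
of the measure `E ↦ μ (E g⁻¹)`, which is the inverse of `Δ g`. -/
noncomputable def modularFn (g : G) : ℝ≥0 := (Measure.modularCharacter g)⁻¹

theorem modularFn_pos (g : G) : 0 < modularFn g :=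
  inv_pos.2 (Measure.modularCharacterFun_pos g)

theorem modularFn_inv (g : G) : modularFn g⁻¹ = (modularFn g)⁻¹ := by
  unfold modularFn
  congr 1
  exact eq_inv_of_mul_eq_one_left (by rw [← map_mul]; simp)

variable [SecondCountableTopology G] [MeasurableSpace G] [BorelSpace G]

theorem lintegral_mul_right (μ : Measure G) [μ.IsHaarMeasure] (g : G) (f : G → ℝ≥0∞) :
    ∫⁻ x, f (x * g) ∂μ = modularFn g⁻¹ * ∫⁻ x, f x ∂μ := by
  have h : μ.map (· * g) = (modularFn g⁻¹) • μ := by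
    rw [modularFn_inv, modularFn, inv_inv]
    change _ = Measure.modularCharacterFun g • μ
    rw [Measure.modularCharacterFun_eq_haarScalarFactor μ g]
    exact Measure.isMulLeftInvariant_eq_smul _ μ
  have h2 : ∫⁻ x, f x ∂(μ.map (· * g)) = ∫⁻ x, f (x * g) ∂μ :=
    lintegral_map_equiv f (MeasurableEquiv.mulRight g)
  rw [← h2, h, lintegral_smul_measure]
  rfl

theorem exists_measurable_lintegral (μ : Measure G) [μ.IsHaarMeasure] :
    ∃ k : G → ℝ≥0∞, Measurable k ∧ ∫⁻ x, k x ∂μ ≠ 0 ∧ ∫⁻ x, k x ∂μ ≠ ∞ := by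
  obtain ⟨K, -⟩ : ∃ K : TopologicalSpace.PositiveCompacts G, True :=
    ⟨Classical.arbitrary _, trivial⟩
  have hKm : MeasurableSet (closure (K : Set G)) := isClosed_closure.measurableSet
  refine ⟨(closure (K : Set G)).indicator 1, measurable_one.indicator hKm, ?_, ?_⟩
  · rw [lintegral_indicator_one hKm]
    exact (lt_of_lt_of_le (Measure.measure_pos_of_nonempty_interior μ K.interior_nonempty)
      (measure_mono subset_closure)).ne'
  · rw [lintegral_indicator_one hKm]
    exact K.isCompact.closure.measure_lt_top.ne

theorem measurable_modularFn_inv : Measurable fun g : G => (modularFn g⁻¹ : ℝ≥0∞) := by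
  obtain ⟨k, hk, h0, h1⟩ := exists_measurable_lintegral (Measure.haar : Measure G)
  have h : (fun g : G => (modularFn g⁻¹ : ℝ≥0∞)) =
      fun g => (∫⁻ x, k (x * g) ∂Measure.haar) / ∫⁻ x, k x ∂Measure.haar := by
    funext g
    rw [lintegral_mul_right, ENNReal.mul_div_cancel_right h0 h1]
  rw [h]
  refine Measurable.div_const ?_ _
  exact Measurable.lintegral_prod_left' (f := fun p : G × G => k (p.1 * p.2)) (by fun_prop)

theorem lintegral_inv (μ : Measure G) [μ.IsHaarMeasure] {f : G → ℝ≥0∞} (hf : Measurable f) :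
    ∫⁻ x, modularFn x⁻¹ * f x⁻¹ ∂μ = ∫⁻ x, f x ∂μ := by
  obtain ⟨k, hk, h0, h1⟩ := exists_measurable_lintegral μ
  refine (ENNReal.mul_right_inj h0 h1).1 ?_
  calc (∫⁻ y, k y ∂μ) * ∫⁻ x, modularFn x⁻¹ * f x⁻¹ ∂μ
      = ∫⁻ x, (∫⁻ y, k y ∂μ) * (modularFn x⁻¹ * f x⁻¹) ∂μ := (lintegral_const_mul' _ _ h1).symm
    _ = ∫⁻ x, ∫⁻ y, k (y * x) * f x⁻¹ ∂μ ∂μ := by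
        refine lintegral_congr fun x => ?_
        rw [lintegral_mul_const _ (by fun_prop), lintegral_mul_right μ x k]
        ring
    _ = ∫⁻ y, ∫⁻ x, k (y * x) * f x⁻¹ ∂μ ∂μ := by
        rw [lintegral_lintegral_swap]
        exact Measurable.aemeasurable (by fun_prop)
    _ = ∫⁻ y, ∫⁻ x, k x * f (x⁻¹ * y) ∂μ ∂μ := by
        refine lintegral_congr fun y => ?_
        rw [← lintegral_mul_left_eq_self (fun x => k x * f (x⁻¹ * y)) y]
        simp
    _ = ∫⁻ x, ∫⁻ y, k x * f (x⁻¹ * y) ∂μ ∂μ := by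
        rw [lintegral_lintegral_swap]
        exact Measurable.aemeasurable (by fun_prop)
    _ = ∫⁻ x, k x * ∫⁻ y, f y ∂μ ∂μ := by
        refine lintegral_congr fun x => ?_
        rw [lintegral_const_mul _ (by fun_prop), lintegral_mul_left_eq_self f x⁻¹]
    _ = (∫⁻ y, k y ∂μ) * ∫⁻ x, f x ∂μ := lintegral_mul_const _ hk

end Modular

instance {G : Type*} [Group G] [TopologicalSpace G] [LocallyCompactSpace G]
    (H : ClosedSubgroup G) : LocallyCompactSpace H :=
  IsClosed.locallyCompactSpace (s := (H : Set G)) H.isClosed'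

instance {G : Type*} [Group G] [TopologicalSpace G] [IsTopologicalGroup G]
    (H : ClosedSubgroup G) : IsTopologicalGroup H :=
  inferInstanceAs (IsTopologicalGroup H.toSubgroup)

instance {G : Type*} [Group G] [TopologicalSpace G] [SecondCountableTopology G]
    (H : ClosedSubgroup G) : SecondCountableTopology H :=
  inferInstanceAs (SecondCountableTopology (H : Set G))

/-! ### Unitary representations and their Gårding domains -/

section Representations

variable {G : Type*} [Group G] [TopologicalSpace G]
  {E : Type*} [NormedAddCommGroup E] [InnerProductSpace ℂ E]

/-- A homomorphism into the unitary group of `E` is a (unitary) representation of `G` if it is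
continuous for the strong operator topology. -/
def IsStronglyContinuous (π : G →* (E ≃ₗᵢ[ℂ] E)) : Prop := ∀ v : E, Continuous fun g => π g v

variable [MeasurableSpace G]

/-- The vector `π(f) u = ∫ f(g) π(g) u dμ(g)`. -/
noncomputable def smear (μ : Measure G) (π : G →* (E ≃ₗᵢ[ℂ] E)) (f : G → ℂ) (u : E) : E :=
  ∫ g, f g • π g u ∂μ

/-- The Gårding domain: the span of the vectors `π(f) u` with `f ∈ C_c(G)`. -/
def gardingDomain (μ : Measure G) (π : G →* (E ≃ₗᵢ[ℂ] E)) : Submodule ℂ E :=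
  Submodule.span ℂ {w | ∃ f : G → ℂ, Continuous f ∧ HasCompactSupport f ∧ ∃ u : E,
    w = smear μ π f u}

theorem map_mem_gardingDomain [IsTopologicalGroup G] [BorelSpace G] (μ : Measure G)
    [μ.IsMulLeftInvariant] (π : G →* (E ≃ₗᵢ[ℂ] E)) (g : G) {v : E} (hv : v ∈ gardingDomain μ π) :
    π g v ∈ gardingDomain μ π := by
  induction hv using Submodule.span_induction with
  | mem x hx =>
    obtain ⟨f, hf, hfc, u, rfl⟩ := hx
    refine Submodule.subset_span ⟨fun x => f (g⁻¹ * x), by fun_prop,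
      hfc.comp_homeomorph (Homeomorph.mulLeft g⁻¹), u, ?_⟩
    unfold smear
    rw [← integral_mul_left_eq_self (fun x => f (g⁻¹ * x) • π x u) g]
    have := ((π g).toContinuousLinearEquiv.integral_comp_comm (μ := μ) fun x => f x • π x u).symm
    simp only [LinearIsometryEquiv.coe_toContinuousLinearEquiv, map_smul] at this
    simpa using this
  | zero => simp
  | add x y _ _ hx hy => rw [map_add]; exact add_mem hx hy
  | smul c x _ hx => rw [map_smul]; exact Submodule.smul_mem _ c hx

/-- The restriction of `π g` to the Gårding domain. -/
def gardingMap [IsTopologicalGroup G] [BorelSpace G] (μ : Measure G) [μ.IsMulLeftInvariant]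
    (π : G →* (E ≃ₗᵢ[ℂ] E)) (g : G) (v : gardingDomain μ π) : gardingDomain μ π :=
  ⟨π g v, map_mem_gardingDomain μ π g v.2⟩

end Representations

/-! ### The induced representation -/

section Induced

set_option linter.unusedSectionVars false

variable {G : Type*} [Group G] [TopologicalSpace G] [IsTopologicalGroup G] [LocallyCompactSpace G]
  (H : ClosedSubgroup G)

/-- The factor `√(Δ_H h / Δ_G h)`. -/
noncomputable def weight (h : H) : ℝ := Real.sqrt (modularFn h / modularFn (h : G))

variable [MeasurableSpace G]

/-- A function `θ : G → [0, ∞)` that is continuous, satisfies `∫_H θ(g h) dh = 1` for all `g`, and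
for which `K H ∩ supp θ` is compact for all compact `K ⊆ G`. -/
structure CutoffFunction (μH : Measure H) where
  toFun : G → ℝ
  continuous : Continuous toFun
  nonneg : ∀ g, 0 ≤ toFun g
  integral_eq_one : ∀ g, ∫ h : H, toFun (g * h) ∂μH = 1
  isCompact_inter : ∀ K : Set G, IsCompact K → IsCompact ((K * (H : Set G)) ∩ tsupport toFun)

variable {H} {μH : Measure H}

/-- The measure `θ μ_G`. -/
noncomputable def CutoffFunction.measure (θ : CutoffFunction H μH) (μG : Measure G) : Measure G :=
  μG.withDensity fun g => ENNReal.ofReal (θ.toFun g)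

variable {K : Type*} [NormedAddCommGroup K] [InnerProductSpace ℂ K]

/-- `f : G → K` is `μ_G`-measurable and, for every `h ∈ H`, satisfies
`f (g h) = √(Δ_H h / Δ_G h) σ(h⁻¹) f(g)` for `μ_G`-almost all `g`. -/
structure IsCovariant (μG : Measure G) (σ : H →* (K ≃ₗᵢ[ℂ] K)) (f : G → K) : Prop where
  aestronglyMeasurable : AEStronglyMeasurable f μG
  covariant : ∀ h : H, ∀ᵐ g ∂μG, f (g * h) = (weight H h : ℂ) • σ h⁻¹ (f g)

theorem IsCovariant.zero {μG : Measure G} (σ : H →* (K ≃ₗᵢ[ℂ] K)) :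
    IsCovariant μG σ (0 : G → K) :=
  ⟨aestronglyMeasurable_const, fun h => by simp⟩

theorem IsCovariant.add {μG : Measure G} {σ : H →* (K ≃ₗᵢ[ℂ] K)} {f f' : G → K}
    (hf : IsCovariant μG σ f) (hf' : IsCovariant μG σ f') : IsCovariant μG σ (f + f') := by
  refine ⟨hf.1.add hf'.1, fun h => ?_⟩
  filter_upwards [hf.2 h, hf'.2 h] with g h1 h2
  simp [h1, h2]

theorem IsCovariant.smul {μG : Measure G} {σ : H →* (K ≃ₗᵢ[ℂ] K)} {f : G → K} (c : ℂ)
    (hf : IsCovariant μG σ f) : IsCovariant μG σ (c • f) := by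
  refine ⟨hf.1.const_smul c, fun h => ?_⟩
  filter_upwards [hf.2 h] with g h1
  simp [h1, smul_comm c]

theorem IsCovariant.translate [BorelSpace G] {μG : Measure G} [μG.IsMulLeftInvariant]
    {σ : H →* (K ≃ₗᵢ[ℂ] K)} {f : G → K} (x : G) (hf : IsCovariant μG σ f) :
    IsCovariant μG σ (fun g => f (x * g)) := by
  have hx := measurePreserving_mul_left μG x
  refine ⟨hf.1.comp_measurePreserving hx, fun h => ?_⟩
  filter_upwards [hx.quasiMeasurePreserving.ae (hf.2 h)] with g h1
  simpa [mul_assoc] using h1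

/-- `f` is a covariant function representing the class `F ∈ L²(G, θ μ_G; K)`. -/
def Represents (θ : CutoffFunction H μH) (μG : Measure G) (σ : H →* (K ≃ₗᵢ[ℂ] K))
    (F : Lp K 2 (θ.measure μG)) (f : G → K) : Prop :=
  IsCovariant μG σ f ∧ F =ᵐ[θ.measure μG] f

/-- The Hilbert space of the induced representation: the subspace of `L²(G, θ μ_G; K)` of the
classes of covariant functions. -/
def indSpace (θ : CutoffFunction H μH) (μG : Measure G) (σ : H →* (K ≃ₗᵢ[ℂ] K)) :
    Submodule ℂ (Lp K 2 (θ.measure μG)) where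
  carrier := {F | ∃ f : G → K, Represents θ μG σ F f}
  zero_mem' := ⟨0, .zero σ, Lp.coeFn_zero _ _ _⟩
  add_mem' := by
    rintro F F' ⟨f, hf, hF⟩ ⟨f', hf', hF'⟩
    exact ⟨f + f', hf.add hf', (Lp.coeFn_add F F').trans (hF.add hF')⟩
  smul_mem' := by
    rintro c F ⟨f, hf, hF⟩
    exact ⟨c • f, hf.smul c, (Lp.coeFn_smul c F).trans (hF.const_smul c)⟩

variable [BorelSpace G] [SecondCountableTopology G]

theorem CutoffFunction.lintegral_eq_one (θ : CutoffFunction H μH) (g : G) :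
    ∫⁻ h : H, ENNReal.ofReal (θ.toFun (g * h)) ∂μH = 1 := by
  have hi : Integrable (fun h : H => θ.toFun (g * h)) μH := by
    by_contra hn
    have := θ.integral_eq_one g
    rw [integral_undef hn] at this
    exact zero_ne_one this
  rw [← ofReal_integral_eq_lintegral_ofReal hi (ae_of_all _ fun _ => θ.nonneg _),
    θ.integral_eq_one, ENNReal.ofReal_one]

variable [μH.IsHaarMeasure] {μG : Measure G} [μG.IsHaarMeasure]

/-- For `φ ≥ 0` with `φ (g h) = (Δ_H h / Δ_G h) φ g`, the integral of `φ θ` does not depend on the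
choice of `θ`. -/
theorem lintegral_covariant_eq {φ θ₁ θ₂ : G → ℝ≥0∞} (hφ : AEMeasurable φ μG)
    (h₁ : Measurable θ₁) (h₂ : Measurable θ₂)
    (i₁ : ∀ g, ∫⁻ h : H, θ₁ (g * h) ∂μH = 1) (i₂ : ∀ g, ∫⁻ h : H, θ₂ (g * h) ∂μH = 1)
    (hc : ∀ h : H, ∀ᵐ g ∂μG, φ (g * h) = (modularFn h / modularFn (h : G) : ℝ≥0) * φ g) :
    ∫⁻ g, φ g * θ₁ g ∂μG = ∫⁻ g, φ g * θ₂ g ∂μG := by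
  have hm₁ : Measurable fun p : G × H => θ₁ (p.1 * p.2) := by fun_prop
  have hm₂ : Measurable fun p : G × H => θ₂ (p.1 * p.2) := by fun_prop
  calc ∫⁻ g, φ g * θ₁ g ∂μG
      = ∫⁻ g, ∫⁻ h : H, φ g * θ₁ g * θ₂ (g * h) ∂μH ∂μG := by
        refine lintegral_congr fun g => ?_
        rw [lintegral_const_mul _ (by fun_prop), i₂, mul_one]
    _ = ∫⁻ h : H, ∫⁻ g, φ g * θ₁ g * θ₂ (g * h) ∂μG ∂μH := by
        rw [lintegral_lintegral_swap]
        exact ((hφ.mul h₁.aemeasurable).comp_fst).mul hm₂.aemeasurable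
    _ = ∫⁻ h : H, ∫⁻ g, modularFn h⁻¹ * (φ g * θ₁ (g * ((h⁻¹ : H) : G)) * θ₂ g) ∂μG ∂μH := by
        refine lintegral_congr fun h => ?_
        have hG := lintegral_mul_right μG ((h⁻¹ : H) : G) fun g => φ g * θ₁ g * θ₂ (g * h)
        have e : (((h⁻¹ : H) : G)⁻¹) = h := by simp
        rw [e] at hG
        have hne : (modularFn (h : G) : ℝ≥0∞) ≠ 0 := by
          simpa using (modularFn_pos (h : G)).ne'
        refine (ENNReal.mul_right_inj hne ENNReal.coe_ne_top).1 ?_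
        rw [← hG, ← lintegral_const_mul' _ _ ENNReal.coe_ne_top]
        refine lintegral_congr_ae ?_
        filter_upwards [hc h⁻¹] with g hg
        rw [hg]
        have e2 : g * ((h⁻¹ : H) : G) * (h : G) = g := by simp
        have e3 : modularFn h⁻¹ / modularFn (((h⁻¹ : H) : G)) = modularFn (h : G) * modularFn h⁻¹ := by
          have : ((h⁻¹ : H) : G) = (h : G)⁻¹ := by simp
          rw [this, modularFn_inv (h : G), div_inv_eq_mul, mul_comm]
        rw [e2, e3, ENNReal.coe_mul]
        ring
    _ = ∫⁻ g, ∫⁻ h : H, modularFn h⁻¹ * (φ g * θ₁ (g * ((h⁻¹ : H) : G)) * θ₂ g) ∂μH ∂μG := by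
        have hm : Measurable fun h : H => (modularFn h⁻¹ : ℝ≥0∞) := measurable_modularFn_inv
        rw [lintegral_lintegral_swap]
        refine AEMeasurable.mul ?_ (((hφ.comp_snd).mul ?_).mul ?_)
        · exact (hm.comp measurable_fst).aemeasurable
        · exact Measurable.aemeasurable (by fun_prop)
        · exact (h₂.comp measurable_snd).aemeasurable
    _ = ∫⁻ g, φ g * θ₂ g ∂μG := by
        refine lintegral_congr fun g => ?_
        have := lintegral_inv μH (f := fun h : H => φ g * θ₁ (g * h) * θ₂ g) (by fun_prop)
        rw [this, lintegral_mul_const _ (by fun_prop), lintegral_const_mul _ (by fun_prop), i₁,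
          mul_one]

variable {σ : H →* (K ≃ₗᵢ[ℂ] K)} {θ : CutoffFunction H μH}

theorem CutoffFunction.measure_absolutelyContinuous (θ : CutoffFunction H μH) (μG : Measure G) :
    θ.measure μG ≪ μG := withDensity_absolutelyContinuous _ _

theorem CutoffFunction.measurable (θ : CutoffFunction H μH) :
    Measurable fun g => ENNReal.ofReal (θ.toFun g) :=
  θ.continuous.measurable.ennreal_ofReal

theorem weight_enorm_sq (h : H) :
    ‖(weight H h : ℂ)‖ₑ ^ 2 = (modularFn h / modularFn (h : G) : ℝ≥0) := by
  have h0 : (0 : ℝ) ≤ weight H h := Real.sqrt_nonneg _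
  rw [← ofReal_norm, Complex.norm_real, Real.norm_of_nonneg h0, ← ENNReal.ofReal_pow h0, weight,
    Real.sq_sqrt (by positivity), ← NNReal.coe_div, ENNReal.ofReal_coe_nnreal]

theorem IsCovariant.enorm_sq {f : G → K} (hf : IsCovariant μG σ f) (h : H) :
    ∀ᵐ g ∂μG, ‖f (g * h)‖ₑ ^ 2 = (modularFn h / modularFn (h : G) : ℝ≥0) * ‖f g‖ₑ ^ 2 := by
  filter_upwards [hf.2 h] with g hg
  rw [hg, enorm_smul, mul_pow, weight_enorm_sq, LinearIsometryEquiv.enorm_map]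

theorem lintegral_enorm_translate {f : G → K} (hf : IsCovariant μG σ f) (x : G) :
    ∫⁻ g, ‖f (x * g)‖ₑ ^ 2 * ENNReal.ofReal (θ.toFun g) ∂μG =
      ∫⁻ g, ‖f g‖ₑ ^ 2 * ENNReal.ofReal (θ.toFun g) ∂μG := by
  have h := lintegral_mul_left_eq_self (μ := μG)
    (fun g => ‖f g‖ₑ ^ 2 * ENNReal.ofReal (θ.toFun (x⁻¹ * g))) x
  simp only [inv_mul_cancel_left] at h
  rw [h]
  refine lintegral_covariant_eq (μH := μH) (hf.1.enorm.pow_const 2)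
    (θ.measurable.comp (measurable_const_mul x⁻¹)) θ.measurable (fun g => ?_)
    θ.lintegral_eq_one hf.enorm_sq
  simpa [mul_assoc] using θ.lintegral_eq_one (x⁻¹ * g)

theorem eLpNorm_measure {f : G → K} (hf : AEStronglyMeasurable f μG) :
    eLpNorm f 2 (θ.measure μG) =
      (∫⁻ g, ‖f g‖ₑ ^ 2 * ENNReal.ofReal (θ.toFun g) ∂μG) ^ (1 / 2 : ℝ) := by
  rw [eLpNorm_eq_lintegral_rpow_enorm_toReal (by simp) (by simp), CutoffFunction.measure,
    lintegral_withDensity_eq_lintegral_mul₀ θ.measurable.aemeasurable]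
  · simp [mul_comm]
  · exact hf.enorm.pow_const _

theorem IsCovariant.eLpNorm_translate {f : G → K} (hf : IsCovariant μG σ f) (x : G) :
    eLpNorm (fun g => f (x * g)) 2 (θ.measure μG) = eLpNorm f 2 (θ.measure μG) := by
  rw [eLpNorm_measure hf.1, eLpNorm_measure (hf.translate x).1, lintegral_enorm_translate hf]

/-- Covariant functions that agree `θ μ_G`-almost everywhere agree `μ_G`-almost everywhere. -/
theorem IsCovariant.ae_eq {f f' : G → K} (hf : IsCovariant μG σ f) (hf' : IsCovariant μG σ f')
    (h : f =ᵐ[θ.measure μG] f') : f =ᵐ[μG] f' := by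
  have hd : IsCovariant μG σ (f + (-1 : ℂ) • f') := hf.add (hf'.smul _)
  set φ : G → ℝ≥0∞ := fun g => ‖(f + (-1 : ℂ) • f') g‖ₑ ^ 2 with hφ
  have hφm : AEMeasurable φ μG := hd.1.enorm.pow_const 2
  have h0 : ∫⁻ g, φ g * ENNReal.ofReal (θ.toFun g) ∂μG = 0 := by
    have e : ∫⁻ g, φ g * ENNReal.ofReal (θ.toFun g) ∂μG = ∫⁻ g, φ g ∂(θ.measure μG) := by
      rw [CutoffFunction.measure,
        lintegral_withDensity_eq_lintegral_mul₀ θ.measurable.aemeasurable hφm]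
      simp [mul_comm]
    rw [e]
    refine (lintegral_congr_ae ?_).trans lintegral_zero
    filter_upwards [h] with g hg
    simp [hφ, hg]
  have hm : Measurable fun p : G × H => ENNReal.ofReal (θ.toFun (p.1 * p.2)) :=
    θ.measurable.comp (g := fun g => ENNReal.ofReal (θ.toFun g)) (by fun_prop)
  have h1 : ∫⁻ g, φ g ∂μG = 0 := by
    calc ∫⁻ g, φ g ∂μG
        = ∫⁻ g, ∫⁻ h : H, φ g * ENNReal.ofReal (θ.toFun (g * h)) ∂μH ∂μG := by
          refine lintegral_congr fun g => ?_
          have hg : Measurable fun h : H => ENNReal.ofReal (θ.toFun (g * h)) :=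
            θ.measurable.comp (g := fun g => ENNReal.ofReal (θ.toFun g)) (by fun_prop)
          rw [lintegral_const_mul _ hg, θ.lintegral_eq_one, mul_one]
      _ = ∫⁻ h : H, ∫⁻ g, φ g * ENNReal.ofReal (θ.toFun (g * h)) ∂μG ∂μH := by
          rw [lintegral_lintegral_swap]
          exact hφm.comp_fst.mul hm.aemeasurable
      _ = 0 := by
          refine (lintegral_congr fun h => ?_).trans lintegral_zero
          have hG := lintegral_mul_right μG ((h⁻¹ : H) : G)
            fun g => φ g * ENNReal.ofReal (θ.toFun (g * h))
          have e : ∫⁻ g, φ (g * ((h⁻¹ : H) : G)) *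
              ENNReal.ofReal (θ.toFun (g * ((h⁻¹ : H) : G) * h)) ∂μG = 0 := by
            have : ∫⁻ g, φ (g * ((h⁻¹ : H) : G)) *
                ENNReal.ofReal (θ.toFun (g * ((h⁻¹ : H) : G) * h)) ∂μG =
                ∫⁻ g, (modularFn h⁻¹ / modularFn ((h⁻¹ : H) : G) : ℝ≥0) *
                  (φ g * ENNReal.ofReal (θ.toFun g)) ∂μG := by
              refine lintegral_congr_ae ?_
              filter_upwards [hd.enorm_sq h⁻¹] with g hg
              have e2 : g * ((h⁻¹ : H) : G) * (h : G) = g := by simp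
              rw [e2, ← mul_assoc]
              congr 1
            rw [this, lintegral_const_mul' _ _ ENNReal.coe_ne_top, h0, mul_zero]
          rw [e] at hG
          have hne : (modularFn ((h⁻¹ : H) : G)⁻¹ : ℝ≥0∞) ≠ 0 := by
            simpa using (modularFn_pos ((h⁻¹ : H) : G)⁻¹).ne'
          exact (mul_eq_zero.1 hG.symm).resolve_left hne
  filter_upwards [(lintegral_eq_zero_iff' hφm).1 h1] with g hg
  have : f g - f' g = 0 := by simpa [hφ, sub_eq_add_neg] using hg
  exact sub_eq_zero.1 this

theorem Represents.congr {F F' : Lp K 2 (θ.measure μG)} {f : G → K}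
    (h : Represents θ μG σ F f) (h' : Represents θ μG σ F' f) : F = F' :=
  Lp.ext (h.2.trans h'.2.symm)

theorem exists_translate (x : G) (F : indSpace θ μG σ) :
    ∃ F' : indSpace θ μG σ, ‖F'‖ = ‖F‖ ∧ ∀ f : G → K, Represents θ μG σ F f →
      Represents θ μG σ F' (fun g => f (x⁻¹ * g)) := by
  obtain ⟨F, f, hf, hF⟩ := F
  have hmem : MemLp f 2 (θ.measure μG) := (memLp_congr_ae hF).1 (Lp.memLp F)
  have hn := hf.eLpNorm_translate (θ := θ) x⁻¹
  have hmem' : MemLp (fun g => f (x⁻¹ * g)) 2 (θ.measure μG) :=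
    ⟨(hf.translate x⁻¹).1.mono_ac (θ.measure_absolutelyContinuous μG), hn ▸ hmem.2⟩
  refine ⟨⟨hmem'.toLp _, _, hf.translate x⁻¹, hmem'.coeFn_toLp⟩, ?_, ?_⟩
  · change ‖hmem'.toLp _‖ = ‖F‖
    rw [Lp.norm_toLp, hn, Lp.norm_def, eLpNorm_congr_ae hF]
  · rintro f' ⟨hf', hF'⟩
    have he : f' =ᵐ[μG] f := hf'.ae_eq hf (hF'.symm.trans hF)
    have he' := (measurePreserving_mul_left μG x⁻¹).quasiMeasurePreserving.ae he
    refine ⟨hf'.translate x⁻¹, hmem'.coeFn_toLp.trans ?_⟩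
    exact (θ.measure_absolutelyContinuous μG).ae_le (he'.mono fun g hg => hg.symm)

/-- The class of `g ↦ f (x⁻¹ g)`, where `f` is any covariant function representing `F`. -/
noncomputable def translate (x : G) (F : indSpace θ μG σ) : indSpace θ μG σ :=
  (exists_translate x F).choose

theorem represents_translate (x : G) {F : indSpace θ μG σ} {f : G → K}
    (h : Represents θ μG σ F f) :
    Represents θ μG σ (translate x F : indSpace θ μG σ) (fun g => f (x⁻¹ * g)) :=
  (exists_translate x F).choose_spec.2 f h

theorem translate_eq_iff {x : G} {F F' : indSpace θ μG σ} {f : G → K}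
    (h : Represents θ μG σ F f) (h' : Represents θ μG σ F' (fun g => f (x⁻¹ * g))) :
    translate x F = F' :=
  Subtype.ext ((represents_translate x h).congr h')

theorem Represents.add {F F' : Lp K 2 (θ.measure μG)} {f f' : G → K}
    (h : Represents θ μG σ F f) (h' : Represents θ μG σ F' f') :
    Represents θ μG σ (F + F') (f + f') :=
  ⟨h.1.add h'.1, (Lp.coeFn_add F F').trans (h.2.add h'.2)⟩

theorem Represents.smul {F : Lp K 2 (θ.measure μG)} {f : G → K} (c : ℂ)
    (h : Represents θ μG σ F f) : Represents θ μG σ (c • F) (c • f) :=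
  ⟨h.1.smul c, (Lp.coeFn_smul c F).trans (h.2.const_smul c)⟩

theorem translate_one (F : indSpace θ μG σ) : translate 1 F = F := by
  obtain ⟨f, hf⟩ := F.2
  exact translate_eq_iff hf (by simpa using hf)

theorem translate_mul (x y : G) (F : indSpace θ μG σ) :
    translate (x * y) F = translate x (translate y F) := by
  obtain ⟨f, hf⟩ := F.2
  refine translate_eq_iff hf ?_
  simpa [mul_assoc] using represents_translate x (represents_translate y hf)

/-- The induced representation `(Ind_x F)(g) = F (x⁻¹ g)`, as a homomorphism into the unitary
group of `indSpace θ μG σ`. -/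
noncomputable def indRep (θ : CutoffFunction H μH) (μG : Measure G) [μG.IsHaarMeasure]
    (σ : H →* (K ≃ₗᵢ[ℂ] K)) : G →* (indSpace θ μG σ ≃ₗᵢ[ℂ] indSpace θ μG σ) where
  toFun x :=
    { toFun := translate x
      invFun := translate x⁻¹
      map_add' := fun F F' => by
        obtain ⟨f, hf⟩ := F.2
        obtain ⟨f', hf'⟩ := F'.2
        exact translate_eq_iff (hf.add hf')
          ((represents_translate x hf).add (represents_translate x hf'))
      map_smul' := fun c F => by
        obtain ⟨f, hf⟩ := F.2
        exact translate_eq_iff (hf.smul c) ((represents_translate x hf).smul c)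
      left_inv := fun F => by rw [← translate_mul, inv_mul_cancel, translate_one]
      right_inv := fun F => by rw [← translate_mul, mul_inv_cancel, translate_one]
      norm_map' := fun F => (exists_translate x F).choose_spec.1 }
  map_one' := LinearIsometryEquiv.ext translate_one
  map_mul' x y := LinearIsometryEquiv.ext (translate_mul x y)

/-! ### Admissible maps and wavelet transforms -/

variable {E : Type*} [NormedAddCommGroup E] [InnerProductSpace ℂ E]

/-- The function `g ↦ A π(g⁻¹) v`. -/
noncomputable def waveletFun {π : G →* (E ≃ₗᵢ[ℂ] E)} (A : gardingDomain μG π →ₗ[ℂ] K)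
    (v : gardingDomain μG π) (g : G) : K :=
  A (gardingMap μG π g⁻¹ v)

/-- Admissible maps for `π` modulo `(H, σ)`. -/
structure IsAdmissible (θ : CutoffFunction H μH) (σ : H →* (K ≃ₗᵢ[ℂ] K))
    {π : G →* (E ≃ₗᵢ[ℂ] E)} (A : gardingDomain μG π →ₗ[ℂ] K) : Prop where
  semi_invariant : ∀ (h : H) (v : gardingDomain μG π),
    σ h (A v) = (weight H h : ℂ) • A (gardingMap μG π (h : G) v)
  aestronglyMeasurable : ∀ v : gardingDomain μG π, AEStronglyMeasurable (waveletFun A v) μG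
  square_integrable : ∃ β : ℝ, 0 < β ∧ ∀ v : gardingDomain μG π,
    ∫⁻ g, ‖waveletFun A v g‖ₑ ^ 2 * ENNReal.ofReal (θ.toFun g) ∂μG ≤
      ENNReal.ofReal (β * ‖(v : E)‖ ^ 2)

/-- `T` intertwines the representations `π` and `ρ`. -/
def Intertwines {E' : Type*} [NormedAddCommGroup E'] [InnerProductSpace ℂ E']
    (π : G →* (E ≃ₗᵢ[ℂ] E)) (ρ : G →* (E' ≃ₗᵢ[ℂ] E')) (T : E →L[ℂ] E') : Prop :=
  ∀ (g : G) (v : E), T (π g v) = ρ g (T v)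

end Induced

end WeakFrobenius

/-!
The proof rests on the following observation. If `T` is a bounded intertwining operator from `π` to
`Ind σ` and `v = π(f) u` is a Gårding vector, then `T v = ∫ f(x) Ind_x (T u) dx`. If `F` is a
covariant function representing `T u`, this class is represented by the convolution
`g ↦ ∫ f(x) F(x⁻¹ g) dx = ∫ f(g x) F(x⁻¹) dx`, which is continuous as soon as `x ↦ F(x⁻¹)` is
locally integrable for `μ_G`. Continuity of `x ↦ Ind_x (T u) = T (π(x) u)` is inherited from `π`, so
strong continuity of `Ind σ` itself is never needed.

Local integrability comes from the identity `lintegral_covariant_swap`, a Fubini argument: if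
`φ (g h) = (Δ_H h / Δ_G h) φ g`, then `∫ φ θ₁ ∫_H θ₂(g h) dh dg` is symmetric in `θ₁` and `θ₂`. With
`θ₁ = θ` and `θ₂` the indicator of a compact set it bounds `∫_C ‖F‖²` by `∫ ‖F‖² θ`
(`exists_setLIntegral_covariant_le`). With `φ` equal to `∞` on a right `H`-invariant set and `0`
elsewhere it shows that such a set is null once it is null for `θ μ_G`; this gives pointwise limits
of covariant functions, hence completeness of the space of `Ind σ` (`isClosed_indSpace`). The
convolution is identified with the Bochner integral in `L²(θ μ_G)` by
`coeFn_integral_smul_translate`, and `exists_continuous_represents` collects these facts.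

An admissible map `A` has an everywhere covariant wavelet transform, bounded by hypothesis on the
Gårding domain. That domain is dense (`dense_gardingDomain`), so the transform extends to a bounded
intertwining operator (`IsAdmissible.exists_intertwiner`), to which the observation applies.
Conversely, evaluating at the identity the continuous representatives of `W v` defines an admissible
map (`exists_admissible_of_intertwines`): continuous functions that agree almost everywhere agree
everywhere, which gives linearity, semi-invariance and uniqueness.
-/

namespace WeakFrobenius

open Filter Topology

/-! ### Integrals of covariant functions -/

section Covariant

set_option linter.unusedSectionVars false

variable {G : Type*} [Group G] [TopologicalSpace G] [IsTopologicalGroup G] [LocallyCompactSpace G]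
  [SecondCountableTopology G] [MeasurableSpace G] [BorelSpace G] {H : ClosedSubgroup G}
  {μH : Measure H} [μH.IsHaarMeasure] {μG : Measure G} [μG.IsHaarMeasure]
  {K : Type*} [NormedAddCommGroup K] [InnerProductSpace ℂ K]
  {σ : H →* (K ≃ₗᵢ[ℂ] K)} {θ : CutoffFunction H μH}

/-- The integral of `φ(g) θ₁(g) θ₂(g h)` over `G × H` is symmetric in `θ₁` and `θ₂`: substitute
`g h⁻¹` for `g` and then `h⁻¹` for `h`; the modular functions cancel. -/
theorem lintegral_covariant_swap {φ θ₁ θ₂ : G → ℝ≥0∞} (hφ : AEMeasurable φ μG)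
    (h₁ : Measurable θ₁) (h₂ : Measurable θ₂)
    (hc : ∀ h : H, ∀ᵐ g ∂μG, φ (g * h) = (modularFn h / modularFn (h : G) : ℝ≥0) * φ g) :
    ∫⁻ g, φ g * θ₁ g * ∫⁻ h : H, θ₂ (g * h) ∂μH ∂μG =
      ∫⁻ g, φ g * θ₂ g * ∫⁻ h : H, θ₁ (g * h) ∂μH ∂μG := by
  have hm₁ : Measurable fun p : G × H => θ₁ (p.1 * p.2) := by fun_prop
  have hm₂ : Measurable fun p : G × H => θ₂ (p.1 * p.2) := by fun_prop
  calc ∫⁻ g, φ g * θ₁ g * ∫⁻ h : H, θ₂ (g * h) ∂μH ∂μG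
      = ∫⁻ g, ∫⁻ h : H, φ g * θ₁ g * θ₂ (g * h) ∂μH ∂μG := by
        refine lintegral_congr fun g => ?_
        rw [lintegral_const_mul _ (by fun_prop)]
    _ = ∫⁻ h : H, ∫⁻ g, φ g * θ₁ g * θ₂ (g * h) ∂μG ∂μH := by
        rw [lintegral_lintegral_swap]
        exact ((hφ.mul h₁.aemeasurable).comp_fst).mul hm₂.aemeasurable
    _ = ∫⁻ h : H, ∫⁻ g, φ g * θ₂ g * (modularFn h⁻¹ * θ₁ (g * ((h⁻¹ : H) : G))) ∂μG ∂μH := by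
        refine lintegral_congr fun h => ?_
        have hG := lintegral_mul_right μG ((h⁻¹ : H) : G) fun g => φ g * θ₁ g * θ₂ (g * h)
        have e : (((h⁻¹ : H) : G)⁻¹) = h := by simp
        rw [e] at hG
        have hne : (modularFn (h : G) : ℝ≥0∞) ≠ 0 := by
          simpa using (modularFn_pos (h : G)).ne'
        refine (ENNReal.mul_right_inj hne ENNReal.coe_ne_top).1 ?_
        rw [← hG, ← lintegral_const_mul' _ _ ENNReal.coe_ne_top]
        refine lintegral_congr_ae ?_
        filter_upwards [hc h⁻¹] with g hg
        have e2 : g * ((h⁻¹ : H) : G) * (h : G) = g := by simp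
        have e3 : modularFn h⁻¹ / modularFn (((h⁻¹ : H) : G)) =
            modularFn (h : G) * modularFn h⁻¹ := by
          have : ((h⁻¹ : H) : G) = (h : G)⁻¹ := by simp
          rw [this, modularFn_inv (h : G), div_inv_eq_mul, mul_comm]
        rw [hg, e2, e3, ENNReal.coe_mul]
        ring
    _ = ∫⁻ g, ∫⁻ h : H, φ g * θ₂ g * (modularFn h⁻¹ * θ₁ (g * ((h⁻¹ : H) : G))) ∂μH ∂μG := by
        have hm : Measurable fun h : H => (modularFn h⁻¹ : ℝ≥0∞) := measurable_modularFn_inv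
        rw [lintegral_lintegral_swap]
        refine ((hφ.comp_snd).mul ?_).mul (AEMeasurable.mul ?_ ?_)
        · exact (h₂.comp measurable_snd).aemeasurable
        · exact (hm.comp measurable_fst).aemeasurable
        · exact Measurable.aemeasurable (by fun_prop)
    _ = ∫⁻ g, φ g * θ₂ g * ∫⁻ h : H, θ₁ (g * h) ∂μH ∂μG := by
        have hm : Measurable fun h : H => (modularFn h⁻¹ : ℝ≥0∞) := measurable_modularFn_inv
        refine lintegral_congr fun g => ?_
        have := lintegral_inv μH (f := fun h : H => θ₁ (g * h)) (by fun_prop)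
        rw [← this]
        exact lintegral_const_mul _ (hm.mul (by fun_prop))

/-- The sets `H ∩ g⁻¹ C` have uniformly bounded Haar measure: a nonempty one is a left translate
by an element of `H` of a subset of `H ∩ C⁻¹ C`. -/
theorem exists_lintegral_indicator_mul_le (μH : Measure H) [μH.IsHaarMeasure] {C : Set G}
    (hC : IsCompact C) :
    ∃ B : ℝ≥0, ∀ g : G, ∫⁻ h : H, C.indicator 1 (g * h) ∂μH ≤ B := by
  have hcpt : IsCompact ((↑) ⁻¹' (C⁻¹ * C) : Set H) :=
    (H.isClosed'.isClosedEmbedding_subtypeVal).isCompact_preimage (hC.inv.mul hC)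
  refine ⟨(μH ((↑) ⁻¹' (C⁻¹ * C) : Set H)).toNNReal, fun g => ?_⟩
  rw [ENNReal.coe_toNNReal hcpt.measure_lt_top.ne]
  by_cases hg : ∃ h₀ : H, g * h₀ ∈ C
  · obtain ⟨h₀, h₀C⟩ := hg
    calc ∫⁻ h : H, C.indicator 1 (g * h) ∂μH
        = ∫⁻ h : H, C.indicator 1 (g * (h₀ * h : H)) ∂μH :=
          (lintegral_mul_left_eq_self (fun h : H => C.indicator 1 (g * (h : G))) h₀).symm
      _ ≤ ∫⁻ h : H, ((↑) ⁻¹' (C⁻¹ * C) : Set H).indicator 1 h ∂μH := by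
          refine lintegral_mono fun h => ?_
          by_cases hh : g * ((h₀ * h : H) : G) ∈ C
          · have : h ∈ ((↑) ⁻¹' (C⁻¹ * C) : Set H) :=
              ⟨(g * h₀)⁻¹, Set.inv_mem_inv.2 h₀C, g * ((h₀ * h : H) : G), hh, by simp⟩
            rw [indicator_of_mem this]
            exact indicator_le_self' (fun _ _ => zero_le) _
          · rw [indicator_of_notMem hh]
            exact zero_le
      _ ≤ μH ((↑) ⁻¹' (C⁻¹ * C) : Set H) := lintegral_indicator_one_le _
  · push Not at hg
    simp [hg]

/-- If `φ` transforms like the squared norm of a covariant function and is integrable for `θ μ_G`,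
then it is locally integrable for `μ_G`. -/
theorem exists_setLIntegral_covariant_le (θ : CutoffFunction H μH) {C : Set G} (hC : IsCompact C)
    (hCm : MeasurableSet C) :
    ∃ B : ℝ≥0, ∀ φ : G → ℝ≥0∞, AEMeasurable φ μG →
      (∀ h : H, ∀ᵐ g ∂μG, φ (g * h) = (modularFn h / modularFn (h : G) : ℝ≥0) * φ g) →
      ∫⁻ g in C, φ g ∂μG ≤ B * ∫⁻ g, φ g * ENNReal.ofReal (θ.toFun g) ∂μG := by
  obtain ⟨B, hB⟩ := exists_lintegral_indicator_mul_le μH hC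
  refine ⟨B, fun φ hφ hc => ?_⟩
  have h := lintegral_covariant_swap (μH := μH) hφ (measurable_one.indicator hCm) θ.measurable hc
  simp only [θ.lintegral_eq_one, mul_one] at h
  calc ∫⁻ g in C, φ g ∂μG = ∫⁻ g, φ g * C.indicator 1 g ∂μG := by
        rw [← lintegral_indicator hCm]
        refine lintegral_congr fun g => ?_
        by_cases hg : g ∈ C <;> simp [hg]
    _ = ∫⁻ g, φ g * ENNReal.ofReal (θ.toFun g) * ∫⁻ h : H, C.indicator 1 (g * h) ∂μH ∂μG := h
    _ ≤ ∫⁻ g, B * (φ g * ENNReal.ofReal (θ.toFun g)) ∂μG := by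
        refine lintegral_mono fun g => ?_
        rw [mul_comm (B : ℝ≥0∞)]
        gcongr
        exact hB g
    _ = B * ∫⁻ g, φ g * ENNReal.ofReal (θ.toFun g) ∂μG :=
        lintegral_const_mul' _ _ ENNReal.coe_ne_top

/-- A set that is right `H`-invariant up to null sets and null for `θ μ_G` is null for `μ_G`. -/
theorem measure_eq_zero_of_rightInvariant {S : Set G} (hS : MeasurableSet S)
    (hinv : ∀ h : H, ∀ᵐ g ∂μG, g * (h : G) ∈ S ↔ g ∈ S) (h0 : θ.measure μG S = 0) : μG S = 0 := by
  -- the function equal to `∞` on `S` and to `0` elsewhere absorbs every positive factor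
  set φ : G → ℝ≥0∞ := S.indicator fun _ => ∞ with hφ
  have hφm : Measurable φ := measurable_const.indicator hS
  have hc : ∀ h : H, ∀ᵐ g ∂μG, φ (g * h) = (modularFn h / modularFn (h : G) : ℝ≥0) * φ g := by
    intro h
    filter_upwards [hinv h] with g hg
    by_cases hgS : g ∈ S
    · have hne : ((modularFn h / modularFn (h : G) : ℝ≥0) : ℝ≥0∞) ≠ 0 :=
        ENNReal.coe_ne_zero.2 (div_pos (modularFn_pos h) (modularFn_pos (h : G))).ne'
      rw [hφ, indicator_of_mem hgS, indicator_of_mem (hg.2 hgS), ENNReal.mul_top hne]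
    · rw [hφ, indicator_of_notMem hgS, indicator_of_notMem (fun h' => hgS (hg.1 h')), mul_zero]
  have h := lintegral_covariant_swap (μH := μH) hφm.aemeasurable (measurable_one (α := ℝ≥0∞))
    θ.measurable hc
  have hz : ∀ᵐ g ∂μG, φ g * ENNReal.ofReal (θ.toFun g) = 0 := by
    have : ∀ᵐ g ∂(θ.measure μG), φ g = 0 := by
      filter_upwards [measure_eq_zero_iff_ae_notMem.1 h0] with g hg
      exact indicator_of_notMem hg _
    filter_upwards [(ae_withDensity_iff θ.measurable).1 this] with g hg
    by_cases hθ : ENNReal.ofReal (θ.toFun g) = 0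
    · rw [hθ, mul_zero]
    · rw [hg hθ, zero_mul]
  have hr : ∫⁻ g, φ g * ENNReal.ofReal (θ.toFun g) * ∫⁻ h : H, (1 : G → ℝ≥0∞) (g * h) ∂μH ∂μG
      = 0 := by
    refine (lintegral_congr_ae ?_).trans lintegral_zero
    filter_upwards [hz] with g hg
    rw [hg, zero_mul]
  rw [hr] at h
  simp only [θ.lintegral_eq_one, Pi.one_apply, mul_one] at h
  refine measure_eq_zero_iff_ae_notMem.2 ?_
  filter_upwards [(lintegral_eq_zero_iff hφm).1 h] with g hg hgS
  simp [hφ, hgS] at hg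

/-- The modular function is bounded on compact sets: if `μ P > 0`, then
`Δ(g) μ(P) = μ(P g) ≤ μ(P C)` for `g ∈ C`. -/
theorem exists_modularFn_le {C : Set G} (hC : IsCompact C) :
    ∃ B : ℝ≥0, ∀ g ∈ C, modularFn g ≤ B := by
  let μ : Measure G := Measure.haar
  obtain ⟨P⟩ : Nonempty (TopologicalSpace.PositiveCompacts G) := inferInstance
  have hPm : MeasurableSet (closure (P : Set G)) := isClosed_closure.measurableSet
  have h0 : μ (closure P) ≠ 0 :=
    ((Measure.measure_pos_of_nonempty_interior μ P.interior_nonempty).trans_le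
      (measure_mono subset_closure)).ne'
  have hPC : IsCompact (closure (P : Set G) * C) := P.isCompact.closure.mul hC
  have hne : μ (closure (P : Set G) * C) / μ (closure P) ≠ ∞ :=
    ENNReal.div_ne_top hPC.measure_lt_top.ne h0
  refine ⟨(μ (closure (P : Set G) * C) / μ (closure P)).toNNReal, fun g hg => ?_⟩
  rw [← ENNReal.coe_le_coe, ENNReal.coe_toNNReal hne,
    ENNReal.le_div_iff_mul_le (Or.inl h0) (Or.inl P.isCompact.closure.measure_lt_top.ne)]
  have h := lintegral_mul_right μ g⁻¹ ((closure (P : Set G)).indicator 1)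
  rw [inv_inv, lintegral_indicator_one hPm] at h
  rw [← h]
  calc ∫⁻ x, (closure (P : Set G)).indicator 1 (x * g⁻¹) ∂μ
      ≤ ∫⁻ x, (closure (P : Set G) * C).indicator 1 x ∂μ := by
        refine lintegral_mono fun x => ?_
        by_cases hx : x * g⁻¹ ∈ closure (P : Set G)
        · have : x ∈ closure (P : Set G) * C := ⟨x * g⁻¹, hx, g, hg, by simp⟩
          rw [indicator_of_mem this]
          exact indicator_le_self' (fun _ _ => zero_le) _
        · rw [indicator_of_notMem hx]
          exact zero_le
    _ ≤ μ (closure (P : Set G) * C) := lintegral_indicator_one_le _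

theorem IsCovariant.congr {f f' : G → K} (hf : IsCovariant μG σ f) (h : f =ᵐ[μG] f') :
    IsCovariant μG σ f' := by
  refine ⟨hf.1.congr h, fun x => ?_⟩
  filter_upwards [hf.2 x, h, (quasiMeasurePreserving_mul_right μG (x : G)).ae h] with g h1 h2 h3
  rw [← h2, ← h3, h1]

theorem Represents.congr_ae {F : Lp K 2 (θ.measure μG)} {f f' : G → K}
    (hf : Represents θ μG σ F f) (h : f =ᵐ[μG] f') : Represents θ μG σ F f' :=
  ⟨hf.1.congr h, hf.2.trans ((θ.measure_absolutelyContinuous μG).ae_le h)⟩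

theorem Represents.exists_stronglyMeasurable {F : Lp K 2 (θ.measure μG)} {f : G → K}
    (hf : Represents θ μG σ F f) :
    ∃ f' : G → K, StronglyMeasurable f' ∧ Represents θ μG σ F f' :=
  ⟨hf.1.1.mk f, hf.1.1.stronglyMeasurable_mk, hf.congr_ae hf.1.1.ae_eq_mk⟩

theorem Represents.lintegral_enorm_sq {F : Lp K 2 (θ.measure μG)} {f : G → K}
    (hf : Represents θ μG σ F f) :
    ∫⁻ g, ‖f g‖ₑ ^ 2 * ENNReal.ofReal (θ.toFun g) ∂μG = ENNReal.ofReal (‖F‖ ^ 2) := by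
  have h := eLpNorm_measure (θ := θ) hf.1.1
  rw [← eLpNorm_congr_ae hf.2] at h
  rw [ENNReal.ofReal_pow (norm_nonneg _), Lp.norm_def, ENNReal.ofReal_toReal (Lp.eLpNorm_ne_top F),
    h, ← ENNReal.rpow_natCast, ← ENNReal.rpow_mul]
  simp

/-- If `f` represents a class in `L²(θ μ_G)`, then `x ↦ f (x⁻¹)` is locally integrable for
`μ_G`: locally, inversion distorts `μ_G` by a bounded factor, and `‖f‖²` is locally integrable. -/
theorem Represents.locallyIntegrable_inv [T2Space G] {F : Lp K 2 (θ.measure μG)} {f : G → K}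
    (hf : Represents θ μG σ F f) : LocallyIntegrable (fun x => f x⁻¹) μG := by
  obtain ⟨f', hf'm, hf'⟩ := hf.exists_stronglyMeasurable
  have hff' : f =ᵐ[μG] f' := hf.1.ae_eq hf'.1 (hf.2.symm.trans hf'.2)
  have hinv : (fun x => f' x⁻¹) =ᵐ[μG] fun x => f x⁻¹ :=
    ((quasiMeasurePreserving_inv μG).ae hff').mono fun x hx => hx.symm
  rw [MeasureTheory.locallyIntegrable_iff]
  intro C hC
  refine IntegrableOn.congr_fun_ae ?_ (ae_restrict_of_ae hinv)
  have hCm := hC.measurableSet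
  have : IsFiniteMeasure (μG.restrict C) := ⟨by simpa using hC.measure_lt_top⟩
  have hm : StronglyMeasurable fun x => f' x⁻¹ := hf'm.comp_measurable measurable_inv
  refine MemLp.integrable (q := 2) (by norm_num) ⟨hm.aestronglyMeasurable, ?_⟩
  rw [eLpNorm_lt_top_iff_lintegral_rpow_enorm_lt_top (by simp) (by simp)]
  obtain ⟨B, hB⟩ := exists_modularFn_le hC
  obtain ⟨D, hD⟩ := exists_setLIntegral_covariant_le (μG := μG) θ hC.inv hC.inv.measurableSet
  have hsq : Measurable fun x => ‖f' x‖ₑ ^ 2 := (hf'm.enorm).pow_const 2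
  calc ∫⁻ x in C, ‖f' x⁻¹‖ₑ ^ (2 : ℝ≥0∞).toReal ∂μG
      = ∫⁻ x, C.indicator (fun x => ‖f' x⁻¹‖ₑ ^ 2) x ∂μG := by
        rw [lintegral_indicator hCm]; simp
    _ ≤ ∫⁻ x, B * (modularFn x⁻¹ * C⁻¹.indicator (fun x => ‖f' x‖ₑ ^ 2) x⁻¹) ∂μG := by
        refine lintegral_mono fun x => ?_
        by_cases hx : x ∈ C
        · have hx' : x⁻¹ ∈ C⁻¹ := by simpa using hx
          rw [indicator_of_mem hx, indicator_of_mem hx', ← mul_assoc, ← ENNReal.coe_mul]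
          refine le_mul_of_one_le_left zero_le (ENNReal.one_le_coe_iff.2 ?_)
          rw [modularFn_inv, ← div_eq_mul_inv, one_le_div (modularFn_pos x)]
          exact hB x hx
        · rw [indicator_of_notMem hx]
          exact zero_le
    _ = B * ∫⁻ x in C⁻¹, ‖f' x‖ₑ ^ 2 ∂μG := by
        rw [lintegral_const_mul' _ _ ENNReal.coe_ne_top,
          lintegral_inv μG (hsq.indicator hC.inv.measurableSet),
          lintegral_indicator hC.inv.measurableSet]
    _ ≤ B * (D * ∫⁻ x, ‖f' x‖ₑ ^ 2 * ENNReal.ofReal (θ.toFun x) ∂μG) := by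
        gcongr
        exact hD _ hsq.aemeasurable hf'.1.enorm_sq
    _ < ∞ := by
        rw [hf'.lintegral_enorm_sq]
        exact ENNReal.mul_lt_top ENNReal.coe_lt_top
          (ENNReal.mul_lt_top ENNReal.coe_lt_top ENNReal.ofReal_lt_top)

end Covariant

/-! ### Smearing a vector of a space of functions -/

section Smear

set_option linter.unusedSectionVars false

variable {G : Type*} [Group G] [TopologicalSpace G] [IsTopologicalGroup G] [LocallyCompactSpace G]
  [SecondCountableTopology G] [MeasurableSpace G] [BorelSpace G]
  {K : Type*} [NormedAddCommGroup K] [InnerProductSpace ℂ K]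

/-- The convolution `∫ f(x) F(x⁻¹ g) dx` equals `∫ f(g x) F(x⁻¹) dx`, where `g` occurs only in the
continuous function `f`; dominated convergence applies. -/
theorem continuous_integral_smul_inv_mul {μ : Measure G} [μ.IsMulLeftInvariant] {f : G → ℂ}
    (hf : Continuous f) (hfc : HasCompactSupport f) {F : G → K}
    (hF : LocallyIntegrable (fun x => F x⁻¹) μ) :
    Continuous fun g => ∫ x, f x • F (x⁻¹ * g) ∂μ := by
  have he : (fun g => ∫ x, f x • F (x⁻¹ * g) ∂μ) = fun g => ∫ x, f (g * x) • F x⁻¹ ∂μ := by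
    funext g
    rw [← integral_mul_left_eq_self (fun x => f x • F (x⁻¹ * g)) g]
    simp
  rw [he]
  refine continuous_iff_continuousAt.2 fun g₀ => ?_
  obtain ⟨N, hN, hg₀⟩ := exists_compact_mem_nhds g₀
  set C : Set G := closure (N⁻¹ * tsupport f) with hCdef
  have hC : IsCompact C := (hN.inv.mul hfc).closure
  have hCm : MeasurableSet C := isClosed_closure.measurableSet
  obtain ⟨B, hB⟩ := hf.bounded_above_of_compact_support hfc
  have hm : AEStronglyMeasurable (fun x => F x⁻¹) μ := hF.aestronglyMeasurable
  have hFC : Integrable (C.indicator fun x => F x⁻¹) μ :=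
    (hF.integrableOn_isCompact hC).integrable_indicator hCm
  refine continuousAt_of_dominated (bound := fun x => B * ‖C.indicator (fun x => F x⁻¹) x‖) ?_ ?_
    (hFC.norm.const_mul B) ?_
  · refine .of_forall fun g => AEStronglyMeasurable.smul ?_ hm
    exact (hf.comp (continuous_const_mul g)).aestronglyMeasurable
  · filter_upwards [hg₀] with g hg
    refine .of_forall fun x => ?_
    by_cases hx : x ∈ C
    · rw [indicator_of_mem hx, norm_smul]
      exact mul_le_mul_of_nonneg_right (hB _) (norm_nonneg _)
    · have : f (g * x) = 0 := by
        refine image_eq_zero_of_notMem_tsupport fun h => hx (subset_closure ?_)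
        exact ⟨g⁻¹, Set.inv_mem_inv.2 hg, g * x, h, by simp⟩
      simp [this, indicator_of_notMem hx]
  · refine .of_forall fun x => ContinuousAt.smul ?_ continuousAt_const
    exact (hf.comp (continuous_mul_const x)).continuousAt

/-- A Bochner integral of left translates, taken in `L²`, is represented by the pointwise
integral.  Both sides have the same integrals over compact sets, by Fubini's theorem. -/
theorem coeFn_integral_smul_translate [T2Space G] [CompleteSpace K] {μ ν : Measure G}
    [μ.IsHaarMeasure] [IsLocallyFiniteMeasure ν] {f : G → ℂ} (hf : Continuous f)
    (hfc : HasCompactSupport f) {Φ : G → Lp K 2 ν} (hΦ : Continuous Φ) {F : G → K}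
    (hFm : StronglyMeasurable F) (hF : ∀ x, Φ x =ᵐ[ν] fun g => F (x⁻¹ * g))
    (hc : Continuous fun g => ∫ x, f x • F (x⁻¹ * g) ∂μ) :
    (∫ x, f x • Φ x ∂μ : Lp K 2 ν) =ᵐ[ν] fun g => ∫ x, f x • F (x⁻¹ * g) ∂μ := by
  have hsΦ : HasCompactSupport fun x => f x • Φ x := hfc.smul_right
  have hcΦ : Continuous fun x => f x • Φ x := hf.smul hΦ
  have hiΦ : Integrable (fun x => f x • Φ x) μ := hcΦ.integrable_of_hasCompactSupport hsΦ
  have hloc : LocallyIntegrable (∫ x, f x • Φ x ∂μ : Lp K 2 ν) ν :=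
    (Lp.memLp _).locallyIntegrable (by norm_num)
  refine (ae_eq_zero_of_forall_setIntegral_isCompact_eq_zero'
    (hloc.sub hc.locallyIntegrable) fun S hS => ?_).mono fun g hg => sub_eq_zero.1 hg
  have hSm := hS.measurableSet
  have hSν : ν S ≠ ∞ := hS.measure_lt_top.ne
  have : IsFiniteMeasure (ν.restrict S) := ⟨by simpa using hS.measure_lt_top⟩
  have hx : ∀ x, (fun g => f x • F (x⁻¹ * g)) =ᵐ[ν] (f x • Φ x : Lp K 2 ν) := fun x => by
    filter_upwards [Lp.coeFn_smul (f x) (Φ x), hF x] with g h1 h2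
    rw [h1, Pi.smul_apply, h2]
  have hxS : ∀ x, (fun g => f x • F (x⁻¹ * g)) =ᵐ[ν.restrict S] (f x • Φ x : Lp K 2 ν) :=
    fun x => ae_restrict_of_ae (hx x)
  have hprod : Integrable (fun p : G × G => f p.1 • F (p.1⁻¹ * p.2)) (μ.prod (ν.restrict S)) := by
    have hm : StronglyMeasurable fun p : G × G => f p.1 • F (p.1⁻¹ * p.2) :=
      (hf.comp continuous_fst).stronglyMeasurable.smul
        (hFm.comp_measurable (by fun_prop : Measurable fun p : G × G => p.1⁻¹ * p.2))
    refine (integrable_prod_iff hm.aestronglyMeasurable).2 ⟨.of_forall fun x => ?_, ?_⟩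
    · have := integrableOn_Lp_of_measure_ne_top (f x • Φ x) (by norm_num) hSν
      exact this.congr (hxS x).symm
    · have hnm : StronglyMeasurable fun x => ∫ g in S, ‖f x • F (x⁻¹ * g)‖ ∂ν :=
        hm.norm.integral_prod_right'
      -- the inner integral is at most `√(ν S)` times the norm of `f x • Φ x`
      refine (hiΦ.norm.const_mul ((ν S) ^ (1 / 2 : ℝ)).toReal).mono' hnm.aestronglyMeasurable
        (.of_forall fun x => ?_)
      rw [Real.norm_of_nonneg (integral_nonneg fun _ => norm_nonneg _)]
      rw [integral_norm_eq_lintegral_enorm ((Lp.aestronglyMeasurable _).restrict.congr (hxS x).symm),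
        ← eLpNorm_one_eq_lintegral_enorm, eLpNorm_congr_ae (hxS x), Lp.norm_def,
        ← ENNReal.toReal_mul]
      have hle := eLpNorm_le_eLpNorm_mul_rpow_measure_univ (μ := ν.restrict S) (p := 1) (q := 2)
        (by norm_num) (Lp.aestronglyMeasurable (f x • Φ x)).restrict
      have hle2 := eLpNorm_mono_measure (p := 2) (f x • Φ x : Lp K 2 ν)
        (Measure.restrict_le_self (μ := ν) (s := S))
      refine ENNReal.toReal_mono (ENNReal.mul_ne_top (by finiteness) (Lp.eLpNorm_ne_top _)) ?_
      refine hle.trans ?_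
      rw [mul_comm, Measure.restrict_apply_univ]
      norm_num
      gcongr
  have key : ∫ g in S, (∫ x, f x • Φ x ∂μ : Lp K 2 ν) g ∂ν =
      ∫ g in S, ∫ x, f x • F (x⁻¹ * g) ∂μ ∂ν := by
    refine ext_inner_left ℂ fun c => ?_
    rw [← L2.inner_indicatorConstLp_eq_inner_setIntegral ℂ hSm hSν, ← integral_inner hiΦ,
      ← integral_integral_swap hprod, ← integral_inner hprod.integral_prod_left]
    refine integral_congr_ae (.of_forall fun x => ?_)
    refine (L2.inner_indicatorConstLp_eq_inner_setIntegral ℂ hSm hSν c _).trans ?_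
    refine congrArg (inner ℂ c) ?_
    exact integral_congr_ae (hxS x).symm
  simp only [Pi.sub_apply]
  rw [integral_sub (hloc.integrableOn_isCompact hS) (hc.locallyIntegrable.integrableOn_isCompact hS),
    key, sub_self]

end Smear

/-! ### Density of the Gårding domain -/

section Density

set_option linter.unusedSectionVars false

variable {G : Type*} [Group G] [TopologicalSpace G] [IsTopologicalGroup G] [LocallyCompactSpace G]
  [SecondCountableTopology G] [MeasurableSpace G] [BorelSpace G]
  {E : Type*} [NormedAddCommGroup E] [InnerProductSpace ℂ E] [CompleteSpace E]

theorem integrable_smul_orbit {μ : Measure G} [IsFiniteMeasureOnCompacts μ]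
    {π : G →* (E ≃ₗᵢ[ℂ] E)} (hπ : IsStronglyContinuous π) {f : G → ℂ} (hf : Continuous f)
    (hfc : HasCompactSupport f) (u : E) : Integrable (fun g => f g • π g u) μ :=
  (hf.smul (hπ u)).integrable_of_hasCompactSupport hfc.smul_right

/-- A vector `w` orthogonal to the Gårding domain satisfies `∫ f(g) ⟪w, π(g) w⟫ dg = 0` for all
`f ∈ C_c(G)`, so the matrix coefficient vanishes at the identity. -/
theorem dense_gardingDomain {μ : Measure G} [μ.IsHaarMeasure] {π : G →* (E ≃ₗᵢ[ℂ] E)}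
    (hπ : IsStronglyContinuous π) : Dense (gardingDomain μ π : Set E) := by
  rw [Submodule.dense_iff_topologicalClosure_eq_top, Submodule.topologicalClosure_eq_top_iff,
    Submodule.eq_bot_iff]
  intro w hw
  by_contra hw0
  obtain ⟨χ, hχ1, -, hχc, hχ⟩ := exists_continuous_one_zero_of_isCompact
    (isCompact_singleton (x := (1 : G))) isClosed_empty (disjoint_empty _)
  have hcoef : Continuous fun g => inner ℂ w (π g w) := by
    have := hπ w
    fun_prop
  -- test against `π(f) w` with `f g = χ g * conj ⟪w, π g w⟫`
  have horth := (Submodule.mem_orthogonal' _ _).1 hw (smear μ π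
    (fun g => (χ g : ℂ) * starRingEnd ℂ (inner ℂ w (π g w))) w)
    (Submodule.subset_span ⟨_, by fun_prop, ?_, w, rfl⟩)
  · have hsupp : HasCompactSupport fun g => χ g * ‖inner ℂ w (π g w)‖ ^ 2 := hχc.mul_right
    have hpos : 0 < ∫ g, χ g * ‖inner ℂ w (π g w)‖ ^ 2 ∂μ := by
      refine Continuous.integral_pos_of_hasCompactSupport_nonneg_nonzero (x := 1) (by fun_prop)
        hsupp (fun g => mul_nonneg (hχ g).1 (by positivity)) ?_
      have : χ 1 = 1 := hχ1 rfl
      simp [this, hw0]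
    refine hpos.ne' ?_
    rw [smear, ← integral_inner] at horth
    · rw [← Complex.ofReal_eq_zero, ← integral_complex_ofReal, ← horth]
      refine integral_congr_ae (.of_forall fun g => ?_)
      simp only [inner_smul_right]
      rw [mul_assoc, mul_comm (starRingEnd ℂ _), Complex.mul_conj, Complex.normSq_eq_norm_sq]
      push_cast
      rfl
    · refine integrable_smul_orbit hπ (by fun_prop) ?_ w
      exact (hχc.comp_left (g := ((↑) : ℝ → ℂ)) (by simp)).mul_right
  · exact (hχc.comp_left (g := ((↑) : ℝ → ℂ)) (by simp)).mul_right

end Density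

/-! ### Completeness of the space of the induced representation -/

section Induced

set_option linter.unusedSectionVars false

variable {G : Type*} [Group G] [TopologicalSpace G] [IsTopologicalGroup G] [LocallyCompactSpace G]
  [SecondCountableTopology G] [MeasurableSpace G] [BorelSpace G] {H : ClosedSubgroup G}
  {μH : Measure H} [μH.IsHaarMeasure] {μG : Measure G} [μG.IsHaarMeasure]
  {K : Type*} [NormedAddCommGroup K] [InnerProductSpace ℂ K]
  {σ : H →* (K ≃ₗᵢ[ℂ] K)} {θ : CutoffFunction H μH}

/-- Convergence in `L²(θ μ_G)` gives a subsequence that converges `θ μ_G`-almost everywhere; by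
covariance the set on which it converges is right `H`-invariant up to null sets, hence conull for
`μ_G`, and the pointwise limit is covariant. -/
theorem isClosed_indSpace [CompleteSpace K] :
    IsClosed (indSpace θ μG σ : Set (Lp K 2 (θ.measure μG))) := by
  refine IsSeqClosed.isClosed fun u F hu hF => ?_
  have hex : ∀ n, ∃ f : G → K, StronglyMeasurable f ∧ Represents θ μG σ (u n) f := fun n =>
    (hu n).elim fun f hf => hf.exists_stronglyMeasurable
  choose f hfm hf using hex
  obtain ⟨ns, -, hns⟩ := (tendstoInMeasure_of_tendsto_Lp hF).exists_seq_tendsto_ae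
  have hlim : ∀ᵐ g ∂(θ.measure μG), Tendsto (fun i => f (ns i) g) atTop (𝓝 (F g)) := by
    filter_upwards [hns, ae_all_iff.2 fun n => (hf n).2] with g h1 h2
    simpa only [h2] using h1
  have hcov : ∀ h : H, ∀ᵐ g ∂μG, ∀ i, f (ns i) (g * h) = (weight H h : ℂ) • σ h⁻¹ (f (ns i) g) :=
    fun h => ae_all_iff.2 fun i => (hf (ns i)).1.2 h
  have hmap : ∀ (h : H) {g : G} {l : K}, (∀ i, f (ns i) (g * h) =
      (weight H h : ℂ) • σ h⁻¹ (f (ns i) g)) → Tendsto (fun i => f (ns i) g) atTop (𝓝 l) →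
      Tendsto (fun i => f (ns i) (g * h)) atTop (𝓝 ((weight H h : ℂ) • σ h⁻¹ l)) :=
    fun h g l hg hl => by
      simp only [hg]
      exact (((σ h⁻¹).continuous.tendsto l).comp hl).const_smul _
  have hS : MeasurableSet {g | ∃ l, Tendsto (fun i => f (ns i) g) atTop (𝓝 l)} :=
    StronglyMeasurable.measurableSet_exists_tendsto fun i => hfm (ns i)
  have hconv : ∀ᵐ g ∂μG, ∃ l, Tendsto (fun i => f (ns i) g) atTop (𝓝 l) := by
    refine measure_eq_zero_of_rightInvariant (θ := θ) hS.compl (fun h => ?_) ?_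
    · have hcov' := (quasiMeasurePreserving_mul_right μG (h : G)).ae (hcov h⁻¹)
      filter_upwards [hcov h, hcov'] with g h1 h2
      refine not_congr ⟨fun ⟨l, hl⟩ => ?_, fun ⟨l, hl⟩ => ⟨_, hmap h h1 hl⟩⟩
      have := hmap h⁻¹ h2 hl
      simp only [InvMemClass.coe_inv, mul_inv_cancel_right] at this
      exact ⟨_, this⟩
    · exact hlim.mono fun g hg => ⟨_, hg⟩
  obtain ⟨f₀, hf₀m, hf₀⟩ :=
    exists_stronglyMeasurable_limit_of_tendsto_ae (fun i => (hfm (ns i)).aestronglyMeasurable) hconv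
  refine ⟨f₀, ⟨hf₀m.aestronglyMeasurable, fun h => ?_⟩, ?_⟩
  · filter_upwards [hf₀, (quasiMeasurePreserving_mul_right μG (h : G)).ae hf₀, hcov h]
      with g h1 h2 h3
    exact tendsto_nhds_unique h2 (hmap h h3 h1)
  · filter_upwards [hlim, (θ.measure_absolutelyContinuous μG).ae_le hf₀] with g h1 h2
    exact tendsto_nhds_unique h1 h2

instance completeSpace_indSpace [CompleteSpace K] : CompleteSpace (indSpace θ μG σ) :=
  isClosed_indSpace.completeSpace_coe

/-! ### Continuous representatives -/

theorem Represents.eq_of_continuous {F : Lp K 2 (θ.measure μG)} {c c' : G → K}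
    (h : Represents θ μG σ F c) (h' : Represents θ μG σ F c') (hc : Continuous c)
    (hc' : Continuous c') : c = c' :=
  (Continuous.ae_eq_iff_eq μG hc hc').1 (h.1.ae_eq h'.1 (h.2.symm.trans h'.2))

theorem IsCovariant.apply_mul_of_continuous {c : G → K} (h : IsCovariant μG σ c)
    (hc : Continuous c) (g : G) (x : H) : c (g * x) = (weight H x : ℂ) • σ x⁻¹ (c g) :=
  congrFun ((Continuous.ae_eq_iff_eq μG (by fun_prop)
    (((σ x⁻¹).continuous.comp hc).const_smul (weight H x : ℂ))).1 (h.2 x)) g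

variable {E : Type*} [NormedAddCommGroup E] [InnerProductSpace ℂ E] {π : G →* (E ≃ₗᵢ[ℂ] E)}

theorem represents_intertwiner_translate {T : E →L[ℂ] indSpace θ μG σ}
    (hT : Intertwines π (indRep θ μG σ) T) {v : E} {f : G → K} (h : Represents θ μG σ (T v) f)
    (x : G) : Represents θ μG σ (T (π x v)) (fun g => f (x⁻¹ * g)) := by
  rw [hT x v]
  exact represents_translate x h

/-- For each fixed `g` and `h` the covariance of `F` may be used under the integral sign, since
`x ↦ x⁻¹ g` preserves null sets. -/
theorem isCovariant_integral_smul [CompleteSpace K] {f : G → ℂ} {F : G → K}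
    (hF : IsCovariant μG σ F) (hc : Continuous fun g => ∫ x, f x • F (x⁻¹ * g) ∂μG) :
    IsCovariant μG σ fun g => ∫ x, f x • F (x⁻¹ * g) ∂μG := by
  refine ⟨hc.aestronglyMeasurable, fun h => .of_forall fun g => ?_⟩
  have hq : Measure.QuasiMeasurePreserving (fun x : G => x⁻¹ * g) μG μG :=
    (quasiMeasurePreserving_mul_right μG g).comp (quasiMeasurePreserving_inv μG)
  have hcomm := (σ h⁻¹).toContinuousLinearEquiv.integral_comp_comm (μ := μG)
    fun x => f x • F (x⁻¹ * g)
  simp only [LinearIsometryEquiv.coe_toContinuousLinearEquiv, map_smul] at hcomm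
  rw [← hcomm, ← integral_smul]
  refine integral_congr_ae ?_
  filter_upwards [hq.ae (hF.2 h)] with x hx
  rw [← mul_assoc, hx, smul_comm]

/-- An intertwining operator maps `π(f) u` to `Ind(f) (T u)`, which is the convolution of `f` with
a function representing `T u`. -/
theorem exists_continuous_represents [T2Space G] [CompleteSpace E] [CompleteSpace K]
    (hπ : IsStronglyContinuous π) {T : E →L[ℂ] indSpace θ μG σ}
    (hT : Intertwines π (indRep θ μG σ) T) {v : E} (hv : v ∈ gardingDomain μG π) :
    ∃ c : G → K, Continuous c ∧ Represents θ μG σ (T v) c := by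
  induction hv using Submodule.span_induction with
  | mem v hv =>
    obtain ⟨f, hf, hfc, u, rfl⟩ := hv
    obtain ⟨F₀, hF₀⟩ := (T u).2
    obtain ⟨F, hFm, hF⟩ := hF₀.exists_stronglyMeasurable
    have hc := continuous_integral_smul_inv_mul hf hfc hF.locallyIntegrable_inv
    have : IsLocallyFiniteMeasure (θ.measure μG) :=
      IsLocallyFiniteMeasure.withDensity_ofReal θ.continuous
    have hΦ : Continuous fun x => (T (π x u) : Lp K 2 (θ.measure μG)) :=
      continuous_subtype_val.comp (T.continuous.comp (hπ u))
    refine ⟨_, hc, isCovariant_integral_smul hF.1 hc, ?_⟩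
    have hsmear : (T (smear μG π f u) : Lp K 2 (θ.measure μG)) =
        ∫ x, f x • (T (π x u) : Lp K 2 (θ.measure μG)) ∂μG := by
      have := ((indSpace θ μG σ).subtypeL.comp T).integral_comp_comm
        (integrable_smul_orbit (μ := μG) hπ hf hfc u)
      simpa [smear] using this.symm
    rw [hsmear]
    exact coeFn_integral_smul_translate hf hfc hΦ hFm
      (fun x => (represents_intertwiner_translate hT hF x).2) hc
  | zero => exact ⟨0, continuous_const, by simpa using ⟨.zero σ, Lp.coeFn_zero _ _ _⟩⟩
  | add v w _ _ hv hw =>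
    obtain ⟨c, hc, h⟩ := hv
    obtain ⟨c', hc', h'⟩ := hw
    exact ⟨c + c', hc.add hc', by simpa using h.add h'⟩
  | smul a v _ hv =>
    obtain ⟨c, hc, h⟩ := hv
    exact ⟨a • c, hc.const_smul a, by simpa using h.smul a⟩

theorem map_mem_gardingDomain_of_intertwines [CompleteSpace E] [CompleteSpace K]
    (hπ : IsStronglyContinuous π) {T : E →L[ℂ] indSpace θ μG σ}
    (hT : Intertwines π (indRep θ μG σ) T) {v : E} (hv : v ∈ gardingDomain μG π) :
    T v ∈ gardingDomain μG (indRep θ μG σ) := by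
  induction hv using Submodule.span_induction with
  | mem v hv =>
    obtain ⟨f, hf, hfc, u, rfl⟩ := hv
    refine Submodule.subset_span ⟨f, hf, hfc, T u, ?_⟩
    rw [smear, ← T.integral_comp_comm (integrable_smul_orbit hπ hf hfc u), smear]
    refine integral_congr_ae (.of_forall fun x => ?_)
    simp only [map_smul, hT x u]
  | zero => simp
  | add v w _ _ hv hw => rw [map_add]; exact add_mem hv hw
  | smul a v _ hv => rw [map_smul]; exact Submodule.smul_mem _ a hv

/-! ### Wavelet transforms of admissible maps -/

theorem waveletFun_one (A : gardingDomain μG π →ₗ[ℂ] K) (v : gardingDomain μG π) :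
    waveletFun A v 1 = A v := by
  unfold waveletFun
  congr 1
  ext
  simp [gardingMap]

theorem waveletFun_add (A : gardingDomain μG π →ₗ[ℂ] K) (v w : gardingDomain μG π) :
    waveletFun A (v + w) = waveletFun A v + waveletFun A w := by
  funext g
  simp only [waveletFun, Pi.add_apply, ← map_add]
  congr 1
  ext
  simp [gardingMap]

theorem waveletFun_smul (A : gardingDomain μG π →ₗ[ℂ] K) (a : ℂ) (v : gardingDomain μG π) :
    waveletFun A (a • v) = a • waveletFun A v := by
  funext g
  simp only [waveletFun, Pi.smul_apply, ← map_smul]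
  congr 1
  ext
  simp [gardingMap]

theorem waveletFun_gardingMap (A : gardingDomain μG π →ₗ[ℂ] K) (x : G) (v : gardingDomain μG π) :
    waveletFun A (gardingMap μG π x v) = fun g => waveletFun A v (x⁻¹ * g) := by
  funext g
  simp only [waveletFun]
  congr 1
  ext
  simp [gardingMap]

theorem weight_inv_mul_weight (h : H) : (weight H h⁻¹ : ℂ) * weight H h = 1 := by
  have h1 : (modularFn h : ℝ) ≠ 0 := NNReal.coe_ne_zero.2 (modularFn_pos h).ne'
  have h2 : (modularFn (h : G) : ℝ) ≠ 0 := NNReal.coe_ne_zero.2 (modularFn_pos (h : G)).ne'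
  rw [← Complex.ofReal_mul, weight, weight, ← Real.sqrt_mul (by positivity)]
  rw [InvMemClass.coe_inv, modularFn_inv, modularFn_inv]
  push_cast
  rw [show (modularFn h : ℝ)⁻¹ / (modularFn (h : G) : ℝ)⁻¹ *
    (modularFn h / modularFn (h : G)) = 1 by field_simp]
  simp

theorem IsAdmissible.isCovariant {A : gardingDomain μG π →ₗ[ℂ] K} (hA : IsAdmissible θ σ A)
    (v : gardingDomain μG π) : IsCovariant μG σ (waveletFun A v) := by
  refine ⟨hA.aestronglyMeasurable v, fun h => .of_forall fun g => ?_⟩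
  rw [waveletFun, waveletFun, hA.semi_invariant, smul_smul, mul_comm, weight_inv_mul_weight,
    one_smul]
  congr 1
  ext
  simp [gardingMap]

theorem IsAdmissible.exists_represents {A : gardingDomain μG π →ₗ[ℂ] K} (hA : IsAdmissible θ σ A)
    (v : gardingDomain μG π) :
    ∃ F : indSpace θ μG σ, Represents θ μG σ F (waveletFun A v) := by
  have hcov := hA.isCovariant v
  obtain ⟨β, -, hβ⟩ := hA.square_integrable
  have hmem : MemLp (waveletFun A v) 2 (θ.measure μG) := by
    refine ⟨hcov.1.mono_ac (θ.measure_absolutelyContinuous μG), ?_⟩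
    rw [eLpNorm_measure hcov.1]
    exact ENNReal.rpow_lt_top_of_nonneg (by norm_num) ((hβ v).trans_lt ENNReal.ofReal_lt_top).ne
  have hrep : Represents θ μG σ (hmem.toLp _) (waveletFun A v) := ⟨hcov, hmem.coeFn_toLp⟩
  exact ⟨⟨hmem.toLp _, _, hrep⟩, hrep⟩

/-- The wavelet transform of an admissible map extends from the dense Gårding domain to a bounded
intertwining operator. -/
theorem IsAdmissible.exists_intertwiner [CompleteSpace E] [CompleteSpace K]
    (hπ : IsStronglyContinuous π) {A : gardingDomain μG π →ₗ[ℂ] K} (hA : IsAdmissible θ σ A) :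
    ∃ T : E →L[ℂ] indSpace θ μG σ,
      (∀ v : gardingDomain μG π, Represents θ μG σ (T v) (waveletFun A v)) ∧
      Intertwines π (indRep θ μG σ) T := by
  choose L hL using hA.exists_represents
  let L' : gardingDomain μG π →ₗ[ℂ] indSpace θ μG σ :=
    { toFun := L
      map_add' := fun v w => Subtype.ext <|
        (hL (v + w)).congr (by rw [waveletFun_add]; exact (hL v).add (hL w))
      map_smul' := fun a v => Subtype.ext <|
        (hL (a • v)).congr (by rw [waveletFun_smul]; exact (hL v).smul a) }
  have hd := dense_gardingDomain (μ := μG) hπ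
  have hdr : DenseRange (gardingDomain μG π).subtype := by
    simpa [DenseRange] using hd
  obtain ⟨β, hβ0, hβ⟩ := hA.square_integrable
  have hbound : ∀ v, ‖L' v‖ ≤ Real.sqrt β * ‖(gardingDomain μG π).subtype v‖ := by
    intro v
    have h := hβ v
    rw [(hL v).lintegral_enorm_sq, ENNReal.ofReal_le_ofReal_iff (by positivity)] at h
    rw [← Real.sqrt_sq (norm_nonneg ((gardingDomain μG π).subtype v)), ← Real.sqrt_mul hβ0.le]
    exact Real.le_sqrt_of_sq_le h
  have hT : ∀ v : gardingDomain μG π,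
      L'.extendOfNorm (gardingDomain μG π).subtype (v : E) = L v :=
    fun v => LinearMap.extendOfNorm_eq hdr ⟨_, hbound⟩ v
  refine ⟨L'.extendOfNorm (gardingDomain μG π).subtype, fun v => by rw [hT]; exact hL v,
    fun x => congrFun (Continuous.ext_on hd ?_ ?_ fun v hv => ?_)⟩
  · exact (ContinuousLinearMap.continuous _).comp (π x).continuous
  · exact (indRep θ μG σ x).continuous.comp (ContinuousLinearMap.continuous _)
  · change L'.extendOfNorm _ ((gardingMap μG π x ⟨v, hv⟩ : gardingDomain μG π) : E) =
      translate x (L'.extendOfNorm _ ((⟨v, hv⟩ : gardingDomain μG π) : E))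
    rw [hT, hT]
    refine (translate_eq_iff (hL ⟨v, hv⟩) ?_).symm
    rw [← waveletFun_gardingMap]
    exact hL _

theorem eq_of_represents_gardingDomain [CompleteSpace E] (hπ : IsStronglyContinuous π)
    {T T' : E →L[ℂ] indSpace θ μG σ} {w : gardingDomain μG π → G → K}
    (hT : ∀ v : gardingDomain μG π, Represents θ μG σ (T v) (w v))
    (hT' : ∀ v : gardingDomain μG π, Represents θ μG σ (T' v) (w v)) : T' = T :=
  ContinuousLinearMap.ext <| congrFun <|
    Continuous.ext_on (dense_gardingDomain (μ := μG) hπ) T'.continuous T.continuous fun v hv =>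
      Subtype.ext ((hT' ⟨v, hv⟩).congr (hT ⟨v, hv⟩))

/-! ### Evaluation at the identity -/

/-- Evaluating the continuous representatives at the identity turns an intertwining operator into
an admissible map whose wavelet transform is the given operator. -/
theorem exists_admissible_of_intertwines [T2Space G] [CompleteSpace E] [CompleteSpace K]
    (hπ : IsStronglyContinuous π) {W : E →L[ℂ] indSpace θ μG σ}
    (hW : Intertwines π (indRep θ μG σ) W) :
    ∃ A : gardingDomain μG π →ₗ[ℂ] K, IsAdmissible θ σ A ∧
      ∀ v : gardingDomain μG π, Continuous (waveletFun A v) ∧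
        Represents θ μG σ (W v) (waveletFun A v) := by
  choose c hc hr using fun v : gardingDomain μG π => exists_continuous_represents hπ hW v.2
  let A : gardingDomain μG π →ₗ[ℂ] K :=
    { toFun := fun v => c v 1
      map_add' := fun v w => congrFun ((hr (v + w)).eq_of_continuous
        (by simpa using (hr v).add (hr w)) (hc _) ((hc v).add (hc w))) 1
      map_smul' := fun a v => congrFun ((hr (a • v)).eq_of_continuous
        (by simpa using (hr v).smul a) (hc _) ((hc v).const_smul a)) 1 }
  have hcA : ∀ v, waveletFun A v = c v := fun v => funext fun g => by
    have h := (hr (gardingMap μG π g⁻¹ v)).eq_of_continuous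
      (represents_intertwiner_translate hW (hr v) g⁻¹) (hc _) ((hc v).comp (by fun_prop))
    have h1 : waveletFun A v g = c (gardingMap μG π g⁻¹ v) 1 := rfl
    rw [h1, h]
    simp
  refine ⟨A, ⟨fun h v => ?_, fun v => ?_, ‖W‖ ^ 2 + 1, by positivity, fun v => ?_⟩, fun v => ?_⟩
  · have h1 : A (gardingMap μG π (h : G) v) = c v (h : G)⁻¹ := by
      rw [← hcA, waveletFun, inv_inv]
    have h2 := (hr v).1.apply_mul_of_continuous (hc v) 1 h⁻¹
    rw [one_mul, inv_inv, InvMemClass.coe_inv] at h2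
    rw [h1, h2, smul_smul, mul_comm, weight_inv_mul_weight, one_smul]
    rfl
  · rw [hcA]
    exact (hc v).aestronglyMeasurable
  · rw [hcA, (hr v).lintegral_enorm_sq]
    refine ENNReal.ofReal_le_ofReal ?_
    have h1 : ‖W v‖ ^ 2 ≤ (‖W‖ * ‖(v : E)‖) ^ 2 := by
      gcongr
      exact W.le_opNorm v
    refine h1.trans ?_
    rw [mul_pow]
    gcongr
    linarith
  · rw [hcA]
    exact ⟨hc v, hr v⟩

end Induced

end WeakFrobenius

theorem mainTheorem2
    {G : Type*} [Group G] [TopologicalSpace G] [IsTopologicalGroup G] [T2Space G]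
    [LocallyCompactSpace G] [SecondCountableTopology G] [MeasurableSpace G] [BorelSpace G]
    (H : ClosedSubgroup G)
    (μG : MeasureTheory.Measure G) [μG.IsHaarMeasure]
    (μH : MeasureTheory.Measure H) [μH.IsHaarMeasure]
    (θ : WeakFrobenius.CutoffFunction H μH)
    {E : Type*} [NormedAddCommGroup E] [InnerProductSpace ℂ E] [CompleteSpace E]
    [TopologicalSpace.SeparableSpace E]
    {K : Type*} [NormedAddCommGroup K] [InnerProductSpace ℂ K] [CompleteSpace K]
    [TopologicalSpace.SeparableSpace K]
    (π : G →* (E ≃ₗᵢ[ℂ] E)) (hπ : WeakFrobenius.IsStronglyContinuous π)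
    (σ : H →* (K ≃ₗᵢ[ℂ] K)) (hσ : WeakFrobenius.IsStronglyContinuous σ) :
    -- wavelet transforms of admissible maps
    (∀ A : WeakFrobenius.gardingDomain μG π →ₗ[ℂ] K, WeakFrobenius.IsAdmissible θ σ A →
      (∀ v : WeakFrobenius.gardingDomain μG π,
        (∃ F ∈ WeakFrobenius.gardingDomain μG (WeakFrobenius.indRep θ μG σ),
          WeakFrobenius.Represents θ μG σ F (WeakFrobenius.waveletFun A v)) ∧
        ∃ c : G → K, Continuous c ∧ WeakFrobenius.waveletFun A v =ᵐ[μG] c) ∧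
      ∃ T : E →L[ℂ] WeakFrobenius.indSpace θ μG σ,
        (∀ v : WeakFrobenius.gardingDomain μG π,
          WeakFrobenius.Represents θ μG σ (T v) (WeakFrobenius.waveletFun A v)) ∧
        WeakFrobenius.Intertwines π (WeakFrobenius.indRep θ μG σ) T ∧
        ∀ T' : E →L[ℂ] WeakFrobenius.indSpace θ μG σ,
          (∀ v : WeakFrobenius.gardingDomain μG π,
            WeakFrobenius.Represents θ μG σ (T' v) (WeakFrobenius.waveletFun A v)) → T' = T) ∧
    -- every bounded intertwining operator is a wavelet transform
    (∀ W : E →L[ℂ] WeakFrobenius.indSpace θ μG σ,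
      WeakFrobenius.Intertwines π (WeakFrobenius.indRep θ μG σ) W →
      ∃ A : WeakFrobenius.gardingDomain μG π →ₗ[ℂ] K,
        WeakFrobenius.IsAdmissible θ σ A ∧
        (∀ v : WeakFrobenius.gardingDomain μG π, Continuous (WeakFrobenius.waveletFun A v) ∧
          WeakFrobenius.Represents θ μG σ (W v) (WeakFrobenius.waveletFun A v)) ∧
        (∀ (v : WeakFrobenius.gardingDomain μG π) (c : G → K), Continuous c →
          WeakFrobenius.Represents θ μG σ (W v) c → A v = c 1) ∧
        ∀ B : WeakFrobenius.gardingDomain μG π →ₗ[ℂ] K, WeakFrobenius.IsAdmissible θ σ B →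
          (∀ v : WeakFrobenius.gardingDomain μG π, Continuous (WeakFrobenius.waveletFun B v) ∧
            WeakFrobenius.Represents θ μG σ (W v) (WeakFrobenius.waveletFun B v)) → B = A) := by
  refine ⟨fun A hA => ?_, fun W hW => ?_⟩
  · obtain ⟨T, hT, hTi⟩ := hA.exists_intertwiner hπ
    refine ⟨fun v => ⟨⟨T v, WeakFrobenius.map_mem_gardingDomain_of_intertwines hπ hTi v.2, hT v⟩,
      ?_⟩, T, hT, hTi, fun T' hT' => WeakFrobenius.eq_of_represents_gardingDomain hπ hT hT'⟩
    obtain ⟨c, hc, hr⟩ := WeakFrobenius.exists_continuous_represents hπ hTi v.2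
    exact ⟨c, hc, (hT v).1.ae_eq hr.1 ((hT v).2.symm.trans hr.2)⟩
  · obtain ⟨A, hA, hAW⟩ := WeakFrobenius.exists_admissible_of_intertwines hπ hW
    have hval : ∀ (v : WeakFrobenius.gardingDomain μG π) (c : G → K), Continuous c →
        WeakFrobenius.Represents θ μG σ (W v) c → A v = c 1 := fun v c hc hr => by
      rw [← WeakFrobenius.waveletFun_one A v, (hAW v).2.eq_of_continuous hr (hAW v).1 hc]
    refine ⟨A, hA, hAW, hval, fun B _ hB => LinearMap.ext fun v => ?_⟩
    rw [hval v _ (hB v).1 (hB v).2, WeakFrobenius.waveletFun_one]
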